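/- Let $|C_4\rangle=\frac14\sum_{x\in\{0,1\}^4}(-1)^{x_1x_2+x_2x_3+x_3x_4}|x_1x_2x_3x_4\rangle$ be the linear cluster state on four qubits, and for $\lambda\in[0,1]$ let $$\rho_4^{WC}=\lambda\,|C_4\rangle\langle C_4|+\frac{1-\lambda}{4}\sum_{i=1}^4 Z_i|C_4\rangle\langle C_4|Z_i$$ be the worst-case state, where $Z_i$ is the Pauli $Z$ operator on qubit $i$. For $\theta\in\mathbb R$ put $|\theta\rangle=\cos\frac\theta2|0\rangle+\sin\frac\theta2|1\rangle$, so that $\{|\theta\rangle,|\theta+\pi\rangle\}$ is the orthonormal basis of a projective measurement in the $X$–$Z$ plane. Let $p(\theta_2,\theta_3)$ be the probability of finding qubits 2 and 3 of $\rho_4^{WC}$ in $|\theta_2\rangle$ and $|\theta_3\rangle$, let $\rho_{1,4}(\theta_2,\theta_3)$ be the resulting normalized state of qubits 1 and 4, and let $C$ denote the (Wootters) concurrence: $C(\rho)=\max\{0,l_1-l_2-l_3-l_4\}$, where $l_1\ge l_2\ge l_3\ge l_4$ are the square roots of the eigenvalues of $\rho\,(Y\otimes Y)\rho^*(Y\otimes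 Y)$. For all $\theta_2,\theta_3\in\mathbb R$ we have $p(\theta_2,\theta_3)>0$ and $$C(\rho_{1,4}(\theta_2,\theta_3))=\max\Big\{0,\ \tfrac12(3\lambda-1)\,|S|+\tfrac12(\lambda-1)\Big\},\qquad S=\sin\theta_2\sin\theta_3 .$$ In particular, the formula holds with $S$ in place of $|S|$ whenever $S\ge0$ (for instance for $\theta_2,\theta_3\in[0,\pi]$). The average localized entanglement $$E(\theta_2,\theta_3)=\sum_{s_2,s_3\in\{0,1\}}p(\theta_2+s_2\pi,\theta_3+s_3\pi)\,C\big(\rho_{1,4}(\theta_2+s_2\pi,\theta_3+s_3\pi)\big)$$ has the same value $\max\{0,\tfrac12(3\lambda-1)|S|+\tfrac12(\lambda-1)\}$. Hence equatorial measurements (those with $|S|=1$, in particular $\theta_2=\theta_3=\frac\pi2$) maximize both $C(\rho_{1,4}(\theta_2,\theta_3))$ and $E(\theta_2,\theta_3)$ over all $\theta_2,\theta_3\in\mathbb R$, and the maximum is $\max\{0,2\lambda-1\}$. -/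

import Mathlib

open scoped Matrix Kronecker

noncomputable section

namespace WCState

/-- Pauli `Y`. -/
def pauliY : Matrix (Fin 2) (Fin 2) ℂ := !![0, -Complex.I; Complex.I, 0]

/-- Linear operators on `n` qubits, as matrices in the computational basis. The basis vectors are
the bit strings `x : Fin n → Fin 2`. -/
abbrev QubitOp (n : ℕ) := Matrix (Fin n → Fin 2) (Fin n → Fin 2) ℂ

/-- Operators on a pair of qubits. -/
abbrev TwoQubitOp := Matrix (Fin 2 × Fin 2) (Fin 2 × Fin 2) ℂ

/-- The linear cluster state `|C_n⟩`: controlled-phase gates between neighbouring qubits, applied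
to `|+⟩^{⊗ n}`. The amplitude of `|x⟩` is `2^{-n/2} ∏ (-1)^{x_i x_{i+1}}`. -/
def clusterKet (n : ℕ) : (Fin n → Fin 2) → ℂ := fun x =>
  ((1 / Real.sqrt (2 ^ n) : ℝ) : ℂ) *
    ∏ i : Fin n, ∏ j : Fin n,
      if (i : ℕ) + 1 = (j : ℕ) then (-1 : ℂ) ^ ((x i : ℕ) * (x j : ℕ)) else 1

/-- The projector `|ψ⟩⟨ψ|` (for a unit vector `ψ`). -/
def ketBra {ι : Type*} (ψ : ι → ℂ) : Matrix ι ι ℂ := Matrix.vecMulVec ψ (star ψ)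

/-- The Pauli operator `Z_i` on qubit `i` of `n`. -/
def pauliZAt (n : ℕ) (i : Fin n) : QubitOp n :=
  Matrix.diagonal fun x => (-1 : ℂ) ^ (x i : ℕ)

/-- The worst-case state
`ρ_n = lam |C_n⟩⟨C_n| + ((1 - lam)/n) ∑ i, Z_i |C_n⟩⟨C_n| Z_i`. -/
def wcState (n : ℕ) (lam : ℝ) : QubitOp n :=
  (lam : ℂ) • ketBra (clusterKet n) +
    (((1 - lam) / n : ℝ) : ℂ) •
      ∑ i : Fin n, pauliZAt n i * ketBra (clusterKet n) * pauliZAt n i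

/-- The X–Z plane qubit state `|θ⟩ = cos (θ/2) |0⟩ + sin (θ/2) |1⟩`. -/
def xzKet (θ : ℝ) : Fin 2 → ℂ :=
  ![((Real.cos (θ / 2) : ℝ) : ℂ), ((Real.sin (θ / 2) : ℝ) : ℂ)]

/-- The map `1 ⊗ |θ₂⟩ ⊗ |θ₃⟩ ⊗ 1` from qubits `1, 4` to four qubits (qubits `1, 2, 3, 4` have
indices `0, 1, 2, 3`). -/
def middleKet (θ₂ θ₃ : ℝ) : Matrix (Fin 4 → Fin 2) (Fin 2 × Fin 2) ℂ :=
  Matrix.of fun x p =>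
    if x 0 = p.1 ∧ x 3 = p.2 then xzKet θ₂ (x 1) * xzKet θ₃ (x 2) else 0

/-- The unnormalized state `⟨θ₂|⟨θ₃| ρ |θ₂⟩|θ₃⟩` of qubits `1, 4`. -/
def unnormalizedPost (ρ : QubitOp 4) (θ₂ θ₃ : ℝ) : TwoQubitOp :=
  (middleKet θ₂ θ₃)ᴴ * ρ * middleKet θ₂ θ₃

/-- The probability of finding the qubits `2, 3` of `ρ` in `|θ₂⟩, |θ₃⟩`. -/
def outcomeProb (ρ : QubitOp 4) (θ₂ θ₃ : ℝ) : ℝ :=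
  (unnormalizedPost ρ θ₂ θ₃).trace.re

/-- The normalized state of qubits `1, 4` after qubits `2, 3` were found in `|θ₂⟩, |θ₃⟩`. -/
def postState (ρ : QubitOp 4) (θ₂ θ₃ : ℝ) : TwoQubitOp :=
  (unnormalizedPost ρ θ₂ θ₃).trace⁻¹ • unnormalizedPost ρ θ₂ θ₃

/-- The spin-flipped state `(Y ⊗ Y) ρ* (Y ⊗ Y)`, where `*` is entrywise complex conjugation. -/
def spinFlip (ρ : TwoQubitOp) : TwoQubitOp :=
  (pauliY ⊗ₖ pauliY) * ρ.map (starRingEnd ℂ) * (pauliY ⊗ₖ pauliY)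

/-- The square roots of the four eigenvalues of `ρ * spinFlip ρ`, with algebraic multiplicity, in
decreasing order. For a density matrix `ρ` these eigenvalues are real and nonnegative. -/
def concurrenceSpectrum (ρ : TwoQubitOp) : List ℝ :=
  ((ρ * spinFlip ρ).charpoly.roots.map fun z => Real.sqrt z.re).sort (fun a b => a ≥ b)

/-- Wootters' concurrence `max {0, l₁ - l₂ - l₃ - l₄}` of a two-qubit density matrix, where
`l₁ ≥ l₂ ≥ l₃ ≥ l₄` are the square roots of the eigenvalues of `ρ * spinFlip ρ`. -/
def concurrence (ρ : TwoQubitOp) : ℝ :=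
  max 0 ((concurrenceSpectrum ρ).getD 0 0 - (concurrenceSpectrum ρ).getD 1 0
    - (concurrenceSpectrum ρ).getD 2 0 - (concurrenceSpectrum ρ).getD 3 0)

/-- The average concurrence between qubits `1, 4` that is localized by the projective measurements
of qubits `2, 3` in the orthonormal bases `{|θ₂⟩, |θ₂ + π⟩}` and `{|θ₃⟩, |θ₃ + π⟩}`. -/
def localizedEntanglement (ρ : QubitOp 4) (θ₂ θ₃ : ℝ) : ℝ :=
  ∑ s₂ : Fin 2, ∑ s₃ : Fin 2,
    outcomeProb ρ (θ₂ + (s₂ : ℕ) * Real.pi) (θ₃ + (s₃ : ℕ) * Real.pi) *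
      concurrence (postState ρ (θ₂ + (s₂ : ℕ) * Real.pi) (θ₃ + (s₃ : ℕ) * Real.pi))

end WCState

end

namespace WCState

open Polynomial Matrix

/-! ### Concurrence from a factorized characteristic polynomial -/

/-! A `Z` error on qubit 1 or 4 commutes with the measurement and stays as a local `Z`; on qubit 2
or 3 it replaces `θ` by `-θ`. So qubits 1, 4 are left in an explicit mixture of real pure states
with probability 1/4 (`unnormalizedPost_wcState`). Since this `ρ` is real, `ρ * spinFlip ρ` is the
square of `ρ (Y ⊗ Y)`, and the numbers `lᵢ` are the absolute values of the eigenvalues of `ρ (Y ⊗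
Y)`. By `det_scalar_sub_outerState_mul` these are `λS`, `-(1-λ)S/2`, `-(1-λ)(1+S)/4` and
`(1-λ)(1-S)/4`. If `λ|S|` is the largest modulus, twice it minus the sum of all four is the claimed
expression; otherwise both sides vanish. The result depends on `|S|` only, so all four outcomes
contribute equally to the average. -/

lemma charpoly_mul_self_of_det {ι : Type*} [Fintype ι] [DecidableEq ι]
    (hι : Even (Fintype.card ι)) (N : Matrix ι ι ℂ) (a b c d : ℂ)
    (h : ∀ w : ℂ, (Matrix.scalar ι w - N).det = (w - a) * (w - b) * (w - c) * (w - d)) :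
    (N * N).charpoly =
      (X - C (a ^ 2)) * (X - C (b ^ 2)) * (X - C (c ^ 2)) * (X - C (d ^ 2)) := by
  apply Polynomial.funext
  intro z
  -- With `z = w²`, the matrix `w² - N²` factors as `(w - N)(w + N)`; the even size removes the sign
  -- when `w + N` is written as `-(-w - N)`.
  obtain ⟨w, rfl⟩ := IsAlgClosed.exists_pow_nat_eq z two_pos
  have h1 : Matrix.scalar ι (w ^ 2) - N * N =
      (Matrix.scalar ι w - N) * -(Matrix.scalar ι (-w) - N) := by
    have hc : Matrix.scalar ι w * N = N * Matrix.scalar ι w :=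
      (Matrix.scalar_commute w (fun _ => Commute.all _ _) N).eq
    rw [map_neg, sq, map_mul]
    noncomm_ring
    rw [hc]
    abel
  rw [Matrix.eval_charpoly, h1, Matrix.det_mul, Matrix.det_neg, h, h, hι.neg_one_pow]
  simp only [eval_mul, eval_sub, eval_X, eval_C]
  ring

/-- Since `l₁ - l₂ - l₃ - l₄` is twice the maximum minus the sum, it is symmetric in the four
values, and their order need not be known. -/
lemma concurrence_eq_of_charpoly (ρ : TwoQubitOp) (a b c d : ℝ)
    (h : (ρ * spinFlip ρ).charpoly =
      (X - C ((a : ℂ) ^ 2)) * (X - C ((b : ℂ) ^ 2)) * (X - C ((c : ℂ) ^ 2)) *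
        (X - C ((d : ℂ) ^ 2))) :
    concurrence ρ =
      max 0 (2 * max |a| (max |b| (max |c| |d|)) - (|a| + |b| + |c| + |d|)) := by
  have hroots : (ρ * spinFlip ρ).charpoly.roots =
      {(a : ℂ) ^ 2, (b : ℂ) ^ 2, (c : ℂ) ^ 2, (d : ℂ) ^ 2} := by
    have : (ρ * spinFlip ρ).charpoly =
        (Multiset.map (fun z => X - C z)
          {(a : ℂ) ^ 2, (b : ℂ) ^ 2, (c : ℂ) ^ 2, (d : ℂ) ^ 2}).prod := by
      rw [h]; simp [mul_assoc]
    rw [this, roots_multiset_prod_X_sub_C]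
  have hsqrt : ∀ r : ℝ, √(((r : ℂ) ^ 2).re) = |r| := fun r => by
    rw [← Complex.ofReal_pow, Complex.ofReal_re, Real.sqrt_sq_eq_abs]
  have hspec : concurrenceSpectrum ρ =
      Multiset.sort ({|a|, |b|, |c|, |d|} : Multiset ℝ) (fun a b => a ≥ b) := by
    unfold concurrenceSpectrum
    rw [hroots]
    simp [hsqrt]
  have hcoe : (concurrenceSpectrum ρ : Multiset ℝ) = {|a|, |b|, |c|, |d|} := by
    rw [hspec, Multiset.sort_eq]
  have hsorted : (concurrenceSpectrum ρ).Pairwise (fun a b => a ≥ b) := by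
    rw [hspec]; exact Multiset.pairwise_sort _ _
  unfold concurrence
  generalize concurrenceSpectrum ρ = L at hcoe hsorted
  have hlen : L.length = 4 := by
    rw [← Multiset.coe_card, hcoe]; rfl
  obtain ⟨p, q, r, s, rfl⟩ : ∃ p q r s, L = [p, q, r, s] := by
    match L, hlen with
    | [p, q, r, s], _ => exact ⟨p, q, r, s, rfl⟩
  have hsum : p + q + r + s = |a| + |b| + |c| + |d| := by
    have := congrArg Multiset.sum hcoe
    simpa [add_assoc] using this
  have hmem : ∀ z, z ∈ [p, q, r, s] ↔ z = |a| ∨ z = |b| ∨ z = |c| ∨ z = |d| := fun z => by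
    rw [← Multiset.mem_coe, hcoe]; simp
  have hle : ∀ z ∈ [p, q, r, s], z ≤ p := by
    simp only [List.pairwise_cons] at hsorted
    intro z hz
    rcases List.mem_cons.1 hz with rfl | hz
    · exact le_rfl
    · exact hsorted.1 z hz
  have hp : p = max |a| (max |b| (max |c| |d|)) := by
    apply le_antisymm
    · rcases (hmem p).1 (by simp) with h | h | h | h <;> simp [h]
    · simp only [max_le_iff]
      exact ⟨hle _ ((hmem _).2 (by simp)), hle _ ((hmem _).2 (by simp)),
        hle _ ((hmem _).2 (by simp)), hle _ ((hmem _).2 (by simp))⟩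
  congr 1
  rw [← hp, ← hsum]
  simp only [List.getD_cons_zero, List.getD_cons_succ]
  ring

/-! ### The state of the outer qubits in closed form -/

/-- The sign `(-1)^b` of a bit. -/
noncomputable def bitSign (b : Fin 2) : ℂ := (-1) ^ (b : ℕ)

/-- The amplitudes `4 ⟨x₁, x₄|⟨θ₂|⟨θ₃|C₄⟩`, where `(c, s)` and `(d, e)` are the amplitudes of
`|θ₂⟩` and `|θ₃⟩`. -/
noncomputable def outerAmp (c s d e : ℂ) (p : Fin 2 × Fin 2) : ℂ :=
  c * d + bitSign p.2 * (c * e) + bitSign p.1 * (s * d) - bitSign p.1 * bitSign p.2 * (s * e)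

/-- The product `(d + b e) (d + b' e)` of amplitudes of qubit `3`, written in terms of
`u = cos θ₃` and `v = sin θ₃`. -/
noncomputable def edgeKernel (u v b b' : ℂ) : ℂ := (1 + u) / 2 + b * b' * ((1 - u) / 2) + (b + b') * (v / 2)

/-- The normalized state `|φ⟩⟨φ|` left by measuring the cluster state, where `(x, y)` and `(u, v)`
are cosine and sine of `θ₂` and `θ₃`. -/
noncomputable def outerKernel (x y u v : ℂ) (p q : Fin 2 × Fin 2) : ℂ :=
  1 / 4 * ((1 + x) / 2 * edgeKernel u v (bitSign p.2) (bitSign q.2)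
    + (1 - x) / 2 * (bitSign p.1 * bitSign q.1) * edgeKernel u v (-bitSign p.2) (-bitSign q.2)
    + y / 2 * (bitSign q.1 * edgeKernel u v (bitSign p.2) (-bitSign q.2)
      + bitSign p.1 * edgeKernel u v (-bitSign p.2) (bitSign q.2)))

/-- The normalized state of qubits `1, 4`, where `(x, y)` and `(u, v)` are cosine and sine of `θ₂`
and `θ₃`. -/
noncomputable def outerState (l x y u v : ℂ) : TwoQubitOp := Matrix.of fun p q =>
  (l + (1 - l) / 4 * (bitSign p.1 * bitSign q.1 + bitSign p.2 * bitSign q.2)) *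
      outerKernel x y u v p q
    + (1 - l) / 4 * outerKernel x (-y) u v p q + (1 - l) / 4 * outerKernel x y u (-v) p q

/-- Passing from half angles to full angles makes the entries affine in each of `x`, `y`, `u`, `v`,
which keeps the later determinant tractable. -/
lemma outerKernel_eq (c s d e x y u v : ℂ) (hx : x = c ^ 2 - s ^ 2) (hy : y = 2 * (c * s))
    (h₂ : c ^ 2 + s ^ 2 = 1) (hu : u = d ^ 2 - e ^ 2) (hv : v = 2 * (d * e))
    (h₃ : d ^ 2 + e ^ 2 = 1) (p q : Fin 2 × Fin 2) :
    outerKernel x y u v p q = 1 / 4 * (outerAmp c s d e p * outerAmp c s d e q) := by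
  have e1 : (1 + x) / 2 = c ^ 2 := by rw [hx, ← h₂]; ring
  have e2 : (1 - x) / 2 = s ^ 2 := by rw [hx, ← h₂]; ring
  have e3 : (1 + u) / 2 = d ^ 2 := by rw [hu, ← h₃]; ring
  have e4 : (1 - u) / 2 = e ^ 2 := by rw [hu, ← h₃]; ring
  simp only [outerKernel, edgeKernel, outerAmp, e1, e2, e3, e4, hy, hv]
  ring

lemma sum_fin_four_bits {M : Type*} [AddCommMonoid M] (f : (Fin 4 → Fin 2) → M) :
    ∑ x, f x = ∑ a, ∑ b, ∑ c, ∑ d, f ![a, b, c, d] := by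
  simp only [← (Fin.consEquiv fun _ => Fin 2).sum_comp, Fintype.sum_prod_type]
  refine Finset.sum_congr rfl fun a _ => Finset.sum_congr rfl fun b _ =>
    Finset.sum_congr rfl fun c _ => Finset.sum_congr rfl fun d _ => ?_
  rw [Fintype.sum_unique]
  congr 1

lemma clusterKet_four (a b c d : Fin 2) :
    clusterKet 4 ![a, b, c, d] =
      1 / 4 * (-1) ^ ((a : ℕ) * b) * (-1) ^ ((b : ℕ) * c) * (-1) ^ ((c : ℕ) * d) := by
  have h : √(2 ^ 4 : ℝ) = 4 := by
    rw [show (2 ^ 4 : ℝ) = 4 ^ 2 by norm_num, Real.sqrt_sq (by norm_num)]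
  simp [clusterKet, h, Fin.prod_univ_four, mul_assoc]

lemma conjTranspose_mul_ketBra_mul {ι κ : Type*} [Fintype ι] [Fintype κ]
    (A : Matrix ι κ ℂ) (ψ : ι → ℂ) :
    Aᴴ * ketBra ψ * A = ketBra (Aᴴ *ᵥ ψ) := by
  rw [ketBra, ketBra, Matrix.mul_vecMulVec, Matrix.vecMulVec_mul, Matrix.star_mulVec,
    Matrix.conjTranspose_conjTranspose]

lemma pauliZAt_conj_ketBra (n : ℕ) (i : Fin n) (ψ : (Fin n → Fin 2) → ℂ) :
    pauliZAt n i * ketBra ψ * pauliZAt n i = ketBra fun x => bitSign (x i) * ψ x := by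
  ext x y
  simp [pauliZAt, ketBra, bitSign, Matrix.vecMulVec_apply]
  ring

lemma middleKet_conjTranspose_mulVec (θ₂ θ₃ : ℝ) (ψ : (Fin 4 → Fin 2) → ℂ)
    (p : Fin 2 × Fin 2) :
    ((middleKet θ₂ θ₃)ᴴ *ᵥ ψ) p =
      ∑ b, ∑ c, xzKet θ₂ b * xzKet θ₃ c * ψ ![p.1, b, c, p.2] := by
  have hreal : ∀ θ b, (starRingEnd ℂ) (xzKet θ b) = xzKet θ b := fun θ b => by
    fin_cases b <;> simp only [xzKet] <;> exact Complex.conj_ofReal _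
  have hin : ∀ b c : Fin 2, ∀ a d : Fin 2,
      (middleKet θ₂ θ₃)ᴴ p ![a, b, c, d] * ψ ![a, b, c, d] =
      if a = p.1 then if d = p.2 then xzKet θ₂ b * xzKet θ₃ c * ψ ![a, b, c, d] else 0 else 0 := by
    intro b c a d
    by_cases ha : a = p.1 <;> by_cases hd : d = p.2 <;>
      simp [middleKet, Matrix.conjTranspose_apply, ha, hd, hreal]
  rw [Matrix.mulVec, dotProduct, sum_fin_four_bits]
  simp only [hin]
  rw [Finset.sum_eq_single p.1 (fun a _ ha => by simp [ha]) (by simp)]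
  simp

/-! ### Eigenvalues -/

-- The matrix is `4 (w - ρ (Y ⊗ Y))` written out, with `W = 4w` and `k = (1 + l)/2`.
set_option maxRecDepth 20000 in
set_option maxHeartbeats 1000000 in
lemma det_fin_four_eq (l k x y u v W : ℂ) (hk : l = 2 * k - 1) (hxy : y ^ 2 = 1 - x ^ 2)
    (huv : v ^ 2 = 1 - u ^ 2) :
    (!![W + (l * (x * u) - (2 * l - 1) * (y * v)), -(k * x + l * v), -(k * u + l * y),
          1 + k * (x * v + y * u);
        k * x - l * v, W - (l * (x * u) + (2 * l - 1) * (y * v)), -(1 + k * (y * u - x * v)),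
          k * u + l * y;
        k * u - l * y, -(1 + k * (x * v - y * u)), W - (l * (x * u) + (2 * l - 1) * (y * v)),
          k * x + l * v;
        1 - k * (x * v + y * u), -(k * u - l * y), -(k * x - l * v),
          W + (l * (x * u) - (2 * l - 1) * (y * v))] : Matrix (Fin 4) (Fin 4) ℂ).det =
      (W - 4 * l * (y * v)) * (W + 2 * (1 - l) * (y * v)) *
        (W + (1 - l) * (1 + y * v)) * (W - (1 - l) * (1 - y * v)) := by
  subst hk
  -- Rewriting `y ^ 2` does not reach inside `y ^ 3` or `y ^ 4`, so each power gets its own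
  -- reduction modulo `x² + y² = 1`; likewise for `v`.
  have hy3 : y ^ 3 = (1 - x ^ 2) * y := by rw [← hxy]; ring
  have hy4 : y ^ 4 = (1 - x ^ 2) ^ 2 := by rw [← hxy]; ring
  have hv3 : v ^ 3 = (1 - u ^ 2) * v := by rw [← huv]; ring
  have hv4 : v ^ 4 = (1 - u ^ 2) ^ 2 := by rw [← huv]; ring
  rw [Matrix.det_succ_row_zero]
  simp only [Fin.sum_univ_four, Matrix.det_fin_three]
  simp [Fin.succAbove]
  ring_nf
  simp only [hxy, hy3, hy4, huv, hv3, hv4]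
  ring

lemma det_scalar_sub_outerState_mul (l x y u v w : ℂ) (hxy : y ^ 2 = 1 - x ^ 2)
    (huv : v ^ 2 = 1 - u ^ 2) :
    (Matrix.scalar (Fin 2 × Fin 2) w - outerState l x y u v * (pauliY ⊗ₖ pauliY)).det =
      (w - l * (y * v)) * (w - -((1 - l) / 2 * (y * v))) *
        (w - -((1 - l) / 4 * (1 + y * v))) * (w - (1 - l) / 4 * (1 - y * v)) := by
  -- `Y ⊗ Y` is antidiagonal: it sends each column to the one with both bits flipped, with sign
  -- `-(-1)^(q₁+q₂)`.
  have hcols : (Matrix.scalar (Fin 2 × Fin 2) w - outerState l x y u v * (pauliY ⊗ₖ pauliY)) =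
      Matrix.of fun p q => (if p = q then w else 0) +
        bitSign q.1 * bitSign q.2 * outerState l x y u v p (1 - q.1, 1 - q.2) := by
    ext p ⟨q1, q2⟩
    fin_cases q1 <;> fin_cases q2 <;>
    simp [Matrix.mul_apply, Fintype.sum_prod_type, pauliY, bitSign, Matrix.diagonal_apply,
      sub_eq_add_neg]
  have key := det_fin_four_eq l ((1 + l) / 2) x y u v (4 * w) (by ring) hxy huv
  rw [hcols, ← Matrix.det_reindex_self finProdFinEquiv]
  rw [show ∀ M N : Matrix (Fin 4) (Fin 4) ℂ, M = (1 / 4 : ℂ) • N → M.det = 1 / 256 * N.det from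
    fun M N h => by rw [h, Matrix.det_smul]; norm_num, key]
  · ring
  · ext i j
    fin_cases i <;> fin_cases j <;>
    simp [finProdFinEquiv, Fin.divNat, Fin.modNat, outerState, outerKernel, edgeKernel,
      bitSign] <;> ring

lemma outerState_mul_spinFlip (l x y u v : ℝ) :
    outerState l x y u v * spinFlip (outerState l x y u v) =
      outerState l x y u v * (pauliY ⊗ₖ pauliY) * (outerState l x y u v * (pauliY ⊗ₖ pauliY)) := by
  have hreal : (outerState l x y u v).map (starRingEnd ℂ) = outerState l x y u v := by
    ext p q
    simp [outerState, outerKernel, edgeKernel, bitSign, Complex.conj_ofReal, map_ofNat]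
  rw [spinFlip, hreal]
  simp only [Matrix.mul_assoc]

lemma concurrence_outerState (l x y u v : ℝ) (hl₀ : 0 ≤ l) (hl₁ : l ≤ 1) (hxy : x ^ 2 + y ^ 2 = 1)
    (huv : u ^ 2 + v ^ 2 = 1) :
    concurrence (outerState l x y u v) =
      max 0 (1 / 2 * (3 * l - 1) * |y * v| + 1 / 2 * (l - 1)) := by
  have hxy' : (y : ℂ) ^ 2 = 1 - (x : ℂ) ^ 2 := by
    exact_mod_cast (by linarith : y ^ 2 = 1 - x ^ 2)
  have huv' : (v : ℂ) ^ 2 = 1 - (u : ℂ) ^ 2 := by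
    exact_mod_cast (by linarith : v ^ 2 = 1 - u ^ 2)
  have hchar := charpoly_mul_self_of_det (by decide) _ _ _ _ _
    fun w => det_scalar_sub_outerState_mul l x y u v w hxy' huv'
  rw [← outerState_mul_spinFlip] at hchar
  have hS : |y * v| ≤ 1 := by
    rw [abs_mul]
    exact mul_le_one₀ (abs_le_one_iff_mul_self_le_one.2 (by nlinarith [sq_nonneg x]))
      (abs_nonneg _) (abs_le_one_iff_mul_self_le_one.2 (by nlinarith [sq_nonneg u]))
  rw [concurrence_eq_of_charpoly _ (l * (y * v)) (-((1 - l) / 2 * (y * v)))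
    (-((1 - l) / 4 * (1 + y * v))) ((1 - l) / 4 * (1 - y * v))
    (by rw [hchar]; push_cast; rfl)]
  set S := y * v
  obtain ⟨hS₁, hS₂⟩ := abs_le.1 hS
  have hl : 0 ≤ 1 - l := by linarith
  have ha : |l * S| = l * |S| := by rw [abs_mul, abs_of_nonneg hl₀]
  have hb : |-((1 - l) / 2 * S)| = (1 - l) / 2 * |S| := by
    rw [abs_neg, abs_mul, abs_of_nonneg (by linarith)]
  have hc : |-((1 - l) / 4 * (1 + S))| = (1 - l) / 4 * (1 + S) := by
    rw [abs_neg, abs_of_nonneg (mul_nonneg (by linarith) (by linarith))]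
  have hd : |(1 - l) / 4 * (1 - S)| = (1 - l) / 4 * (1 - S) :=
    abs_of_nonneg (mul_nonneg (by linarith) (by linarith))
  rw [ha, hb, hc, hd]
  -- The larger of `1 ± S` is `1 + |S|`, and it dominates `2|S|` because `|S| ≤ 1`.
  have hmax : max ((1 - l) / 2 * |S|) (max ((1 - l) / 4 * (1 + S)) ((1 - l) / 4 * (1 - S))) =
      (1 - l) / 4 * (1 + |S|) := by
    have h₁ := mul_nonneg hl (sub_nonneg.2 hS)
    rw [← mul_max_of_nonneg _ _ (by linarith : (0 : ℝ) ≤ (1 - l) / 4), sub_eq_add_neg 1 S,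
      max_add_add_left, ← abs_eq_max_neg]
    exact max_eq_right (by linarith)
  rw [hmax]
  have hlS := mul_nonneg hl₀ (abs_nonneg S)
  have hlS' := mul_nonneg hl (abs_nonneg S)
  rcases le_total ((1 - l) / 4 * (1 + |S|)) (l * |S|) with h | h
  · rw [max_eq_left h]
    congr 1
    ring
  -- Here the left side is the positive part of `-l|S|`, and `h` makes the right-hand expression
  -- nonpositive too.
  · rw [max_eq_right h, max_eq_left (by linarith), max_eq_left (by linarith)]

/-! ### The measured worst-case state -/

lemma star_outerAmp (c s d e : ℝ) (p : Fin 2 × Fin 2) :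
    (starRingEnd ℂ) (outerAmp c s d e p) = outerAmp c s d e p := by
  simp [outerAmp, bitSign]

lemma conjTranspose_middleKet_mulVec_clusterKet (θ₂ θ₃ : ℝ) :
    (middleKet θ₂ θ₃)ᴴ *ᵥ clusterKet 4 = fun p =>
      1 / 4 * outerAmp (Real.cos (θ₂ / 2) : ℝ) (Real.sin (θ₂ / 2) : ℝ)
        (Real.cos (θ₃ / 2) : ℝ) (Real.sin (θ₃ / 2) : ℝ) p := by
  ext ⟨a, d⟩
  rw [middleKet_conjTranspose_mulVec]
  simp only [clusterKet_four, Fin.sum_univ_two, xzKet, outerAmp, bitSign]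
  simp
  ring

lemma conjTranspose_middleKet_mulVec_phase (θ₂ θ₃ : ℝ) (i : Fin 4) :
    (middleKet θ₂ θ₃)ᴴ *ᵥ (fun x => bitSign (x i) * clusterKet 4 x) = fun p =>
      1 / 4 * (![bitSign p.1, 1, 1, bitSign p.2] i *
        outerAmp (Real.cos (θ₂ / 2) : ℝ) ((![1, -1, 1, 1] i * Real.sin (θ₂ / 2) : ℝ) : ℂ)
          (Real.cos (θ₃ / 2) : ℝ) ((![1, 1, -1, 1] i * Real.sin (θ₃ / 2) : ℝ) : ℂ) p) := by
  ext ⟨a, d⟩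
  rw [middleKet_conjTranspose_mulVec]
  simp only [clusterKet_four, Fin.sum_univ_two, xzKet, outerAmp]
  fin_cases i <;> simp [bitSign] <;> ring

lemma unnormalizedPost_wcState (l θ₂ θ₃ : ℝ) :
    unnormalizedPost (wcState 4 l) θ₂ θ₃ =
      (1 / 4 : ℂ) • outerState l (Real.cos θ₂ : ℝ) (Real.sin θ₂ : ℝ)
        (Real.cos θ₃ : ℝ) (Real.sin θ₃ : ℝ) := by
  have hcos : ∀ θ : ℝ, ((Real.cos θ : ℝ) : ℂ) =
      ((Real.cos (θ / 2) : ℝ) : ℂ) ^ 2 - ((Real.sin (θ / 2) : ℝ) : ℂ) ^ 2 := fun θ => by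
    have := Real.cos_two_mul' (θ / 2)
    rw [mul_div_cancel₀ θ two_ne_zero] at this
    exact_mod_cast this
  have hsin : ∀ θ : ℝ, ((Real.sin θ : ℝ) : ℂ) =
      2 * (((Real.cos (θ / 2) : ℝ) : ℂ) * ((Real.sin (θ / 2) : ℝ) : ℂ)) := fun θ => by
    have := Real.sin_two_mul (θ / 2)
    rw [mul_div_cancel₀ θ two_ne_zero] at this
    rw [this]; push_cast; ring
  have hone : ∀ θ : ℝ,
      ((Real.cos (θ / 2) : ℝ) : ℂ) ^ 2 + ((Real.sin (θ / 2) : ℝ) : ℂ) ^ 2 = 1 := fun θ => by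
    exact_mod_cast Real.cos_sq_add_sin_sq (θ / 2)
  unfold unnormalizedPost wcState
  simp only [Matrix.mul_add, Matrix.add_mul, Matrix.mul_smul, Matrix.smul_mul,
    pauliZAt_conj_ketBra,
    conjTranspose_mul_ketBra_mul, conjTranspose_middleKet_mulVec_clusterKet,
    conjTranspose_middleKet_mulVec_phase, Fin.sum_univ_four]
  ext p q
  have hb : ∀ b, (starRingEnd ℂ) (bitSign b) = bitSign b := fun b => by simp [bitSign]
  have h₀ := outerKernel_eq _ _ _ _ _ _ _ _ (hcos θ₂) (hsin θ₂) (hone θ₂) (hcos θ₃) (hsin θ₃)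
    (hone θ₃) p q
  -- Errors on the measured qubits: the same kernel at `-θ₂` (`h₂`) and at `-θ₃` (`h₃`), so only the
  -- sine changes sign.
  have h₂ := outerKernel_eq (Real.cos (θ₂ / 2) : ℝ) (-(Real.sin (θ₂ / 2) : ℝ))
    (Real.cos (θ₃ / 2) : ℝ) (Real.sin (θ₃ / 2) : ℝ) (Real.cos θ₂ : ℝ) (-(Real.sin θ₂ : ℝ))
    (Real.cos θ₃ : ℝ) (Real.sin θ₃ : ℝ) (by rw [neg_sq, hcos]) (by rw [hsin]; ring)
    (by rw [neg_sq, hone]) (hcos θ₃) (hsin θ₃) (hone θ₃) p q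
  have h₃ := outerKernel_eq (Real.cos (θ₂ / 2) : ℝ) (Real.sin (θ₂ / 2) : ℝ)
    (Real.cos (θ₃ / 2) : ℝ) (-(Real.sin (θ₃ / 2) : ℝ)) (Real.cos θ₂ : ℝ) (Real.sin θ₂ : ℝ)
    (Real.cos θ₃ : ℝ) (-(Real.sin θ₃ : ℝ)) (hcos θ₂) (hsin θ₂) (hone θ₂)
    (by rw [neg_sq, hcos]) (by rw [hsin]; ring) (by rw [neg_sq, hone]) p q
  simp only [outerState, Matrix.add_apply, Matrix.smul_apply, Matrix.of_apply, ketBra,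
    Matrix.vecMulVec_apply, Pi.star_apply, smul_eq_mul, h₀, h₂, h₃, RCLike.star_def, map_mul,
    star_outerAmp]
  simp [hb, map_ofNat]
  ring

lemma trace_outerState (l x y u v : ℂ) : (outerState l x y u v).trace = 1 := by
  simp [Matrix.trace, Fintype.sum_prod_type, outerState, outerKernel, edgeKernel, bitSign]
  ring

lemma outcomeProb_wcState (l θ₂ θ₃ : ℝ) : outcomeProb (wcState 4 l) θ₂ θ₃ = 1 / 4 := by
  rw [outcomeProb, unnormalizedPost_wcState, Matrix.trace_smul, trace_outerState]
  norm_num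

lemma postState_wcState (l θ₂ θ₃ : ℝ) :
    postState (wcState 4 l) θ₂ θ₃ = outerState l (Real.cos θ₂ : ℝ) (Real.sin θ₂ : ℝ)
      (Real.cos θ₃ : ℝ) (Real.sin θ₃ : ℝ) := by
  rw [postState, unnormalizedPost_wcState, Matrix.trace_smul, trace_outerState, smul_smul]
  norm_num

lemma concurrence_postState_wcState (l : ℝ) (hl₀ : 0 ≤ l) (hl₁ : l ≤ 1) (θ₂ θ₃ : ℝ) :
    concurrence (postState (wcState 4 l) θ₂ θ₃) =
      max 0 (1 / 2 * (3 * l - 1) * |Real.sin θ₂ * Real.sin θ₃| + 1 / 2 * (l - 1)) := by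
  rw [postState_wcState]
  exact concurrence_outerState l _ _ _ _ hl₀ hl₁ (Real.cos_sq_add_sin_sq θ₂)
    (Real.cos_sq_add_sin_sq θ₃)

/-- A shift by `π` only negates a sine, so the average runs over four equal terms of weight 1/4. -/
lemma localizedEntanglement_wcState (l : ℝ) (hl₀ : 0 ≤ l) (hl₁ : l ≤ 1) (θ₂ θ₃ : ℝ) :
    localizedEntanglement (wcState 4 l) θ₂ θ₃ =
      max 0 (1 / 2 * (3 * l - 1) * |Real.sin θ₂ * Real.sin θ₃| + 1 / 2 * (l - 1)) := by
  simp only [localizedEntanglement, outcomeProb_wcState, concurrence_postState_wcState l hl₀ hl₁,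
    Fin.sum_univ_two, Fin.val_zero, Fin.val_one, Nat.cast_zero, Nat.cast_one, zero_mul, one_mul,
    add_zero, Real.sin_add_pi, mul_neg, neg_mul, abs_neg]
  ring

lemma max_zero_linear_le (l S : ℝ) (hS : |S| ≤ 1) :
    max 0 (1 / 2 * (3 * l - 1) * |S| + 1 / 2 * (l - 1)) ≤ max 0 (2 * l - 1) := by
  apply max_le (le_max_left _ _)
  -- For `l ≤ 1/3` both summands are nonpositive; for `l ≥ 1/3` the expression increases with `|S|`
  -- and equals `2l - 1` at `|S| = 1`.
  rcases le_total (3 * l - 1) 0 with h | h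
  · exact le_max_of_le_left (by nlinarith [mul_nonneg (neg_nonneg.2 h) (abs_nonneg S)])
  · exact le_max_of_le_right (by nlinarith [mul_nonneg h (sub_nonneg.2 hS)])

end WCState

theorem mainTheorem7 (lam : ℝ) (hlam₀ : 0 ≤ lam) (hlam₁ : lam ≤ 1) :
    -- every outcome occurs with positive probability, and the concurrence it leaves
    (∀ θ₂ θ₃ : ℝ,
      0 < WCState.outcomeProb (WCState.wcState 4 lam) θ₂ θ₃ ∧
      WCState.concurrence (WCState.postState (WCState.wcState 4 lam) θ₂ θ₃) =
        max 0 (1 / 2 * (3 * lam - 1) * |Real.sin θ₂ * Real.sin θ₃| + 1 / 2 * (lam - 1))) ∧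
    -- the same without the absolute value
    (∀ θ₂ θ₃ : ℝ, 0 ≤ Real.sin θ₂ * Real.sin θ₃ →
      WCState.concurrence (WCState.postState (WCState.wcState 4 lam) θ₂ θ₃) =
        max 0 (1 / 2 * (3 * lam - 1) * (Real.sin θ₂ * Real.sin θ₃) + 1 / 2 * (lam - 1))) ∧
    -- the average over the outcomes of the measurement
    (∀ θ₂ θ₃ : ℝ,
      WCState.localizedEntanglement (WCState.wcState 4 lam) θ₂ θ₃ =
        max 0 (1 / 2 * (3 * lam - 1) * |Real.sin θ₂ * Real.sin θ₃| + 1 / 2 * (lam - 1))) ∧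
    -- equatorial measurements are optimal
    (∀ α β : ℝ, |Real.sin α * Real.sin β| = 1 →
      WCState.concurrence (WCState.postState (WCState.wcState 4 lam) α β) = max 0 (2 * lam - 1) ∧
      WCState.localizedEntanglement (WCState.wcState 4 lam) α β = max 0 (2 * lam - 1) ∧
      ∀ θ₂ θ₃ : ℝ,
        WCState.concurrence (WCState.postState (WCState.wcState 4 lam) θ₂ θ₃) ≤
          WCState.concurrence (WCState.postState (WCState.wcState 4 lam) α β) ∧
        WCState.localizedEntanglement (WCState.wcState 4 lam) θ₂ θ₃ ≤
          WCState.localizedEntanglement (WCState.wcState 4 lam) α β) := by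
  have hC := WCState.concurrence_postState_wcState lam hlam₀ hlam₁
  have hE := WCState.localizedEntanglement_wcState lam hlam₀ hlam₁
  refine ⟨fun θ₂ θ₃ => ⟨?_, hC θ₂ θ₃⟩, fun θ₂ θ₃ hS => ?_, hE, fun α β hS => ?_⟩
  · rw [WCState.outcomeProb_wcState]
    norm_num
  · rw [hC, abs_of_nonneg hS]
  · have hmax : max 0 (1 / 2 * (3 * lam - 1) * |Real.sin α * Real.sin β| + 1 / 2 * (lam - 1)) =
        max 0 (2 * lam - 1) := by
      rw [hS]
      congr 1
      ring
    have hle : ∀ θ₂ θ₃ : ℝ, |Real.sin θ₂ * Real.sin θ₃| ≤ 1 := fun θ₂ θ₃ => by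
      rw [abs_mul]
      exact mul_le_one₀ (Real.abs_sin_le_one _) (abs_nonneg _) (Real.abs_sin_le_one _)
    rw [hC α β, hE α β, hmax]
    refine ⟨rfl, rfl, fun θ₂ θ₃ => ?_⟩
    rw [hC, hE]
    exact ⟨WCState.max_zero_linear_le lam _ (hle _ _),
      WCState.max_zero_linear_le lam _ (hle _ _)⟩
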